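/- \textbf{Theorem (R-NN performance).} A collectible-reward MDP with $n\ge 1$ rewards consists of a set of states, a set of actions with deterministic transitions (one time step each), an initial state $s_0$ and reward states $s_1,\dots,s_n$; a reward of $1$ is received at the first visit to $s_i$, $i=1,\dots,n$ (a visit at time $0$ counts), and each reward can be collected only once. Let $d(s,t)$ be the length of a shortest path from $s$ to $t$. Assume that every reward state can be reached from $s_0$ and from every other reward state, and that distances between rewards are symmetric, $d(s_i,s_j)=d(s_j,s_i)$ for $1\le i,j\le n$. For each $j$ let an option $o_j$ be given that leads from $s_0$ and from every reward state to $s_j$ along a shortest path. Let $\gamma\in[0,1]$ (with $0^0=1$) and $$\mathrm{OPT}=\max_{\sigma\in\mathrm{Sym}(n)}\ \sum_{k=1}^{n}\gamma^{\,d(s_0,s_{\sigma(1)})+\sum_{t=2}^{k} d(s_{\sigma(t-1)},s_{\sigma(t)})}.$$ The policy NN repeatedly follows the option of a nearest reward not yet collected (ties are broken arbitrarily) until all rewards are collected. The policy Random-NN flips a fair coin; on heads it first follows the option $o_j$ of a reward $j$ chosen uniformly at random from $\{1,\dots,n\}$ until it reaches $s_j$, and then runs NN from there with the remaining rewards; on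 tails it runs NN from $s_0$. Rewards passed while an option is followed are collected at that time. A reward collected at time $t$ contributes $\gamma^t$ to the return. Let $\text{R-NN}$ be the expected return of Random-NN. There is an absolute constant $c>0$ such that for every $n\ge 1$, every such MDP with $n$ rewards, every choice of the options and of the tie-breaking, and every $\gamma\in[0,1]$, $$\text{R-NN}\ \ge\ c\,\frac{\log n}{n}\,\mathrm{OPT}.$$ -/

import Mathlib

/-- A collectible-reward MDP with `n` rewards and deterministic dynamics: taking action `a` in
state `s` leads, in one time step, to the state `step s a`; the agent starts in `init`; the
`i`-th reward sits in the state `site i` and can be collected once. -/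
structure CollectibleMDP (S A : Type*) (n : ℕ) where
  step : S → A → S
  init : S
  site : Fin n → S

namespace CollectibleMDP

open Classical in
/-- The local reward signal `R_i`. -/
noncomputable def localReward {S A : Type*} {n : ℕ} (M : CollectibleMDP S A n)
    (i : Fin n) (s : S) : ℝ :=
  if s = M.site i then 1 else 0

/-- The reward received in state `s` when the rewards in `C` have been collected before:
the sum of the local rewards `R_i(s)` over the rewards `i` that are still available. -/
noncomputable def reward {S A : Type*} {n : ℕ} (M : CollectibleMDP S A n)
    (C : Finset (Fin n)) (s : S) : ℝ :=
  ∑ i ∈ Cᶜ, M.localReward i s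

/-- The length of a shortest path from `s` to `t`: the least number of actions that lead
from `s` to `t`. (The value is only used where `t` can be reached from `s`.) -/
noncomputable def dist {S A : Type*} {n : ℕ} (M : CollectibleMDP S A n) (s t : S) : ℕ :=
  sInf {k : ℕ | ∃ l : List A, l.length = k ∧ l.foldl M.step s = t}

/-! ### The reward-discounted travelling salesman problem -/

/-- The length of the `k`-th leg (`k = 0, …, n - 1`) of the tour that starts in `init` and visits
the rewards in the order `σ 0, σ 1, …, σ (n - 1)`. -/
noncomputable def tourLeg {S A : Type*} {n : ℕ} (M : CollectibleMDP S A n)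
    (σ : Equiv.Perm (Fin n)) (k : Fin n) : ℕ :=
  M.dist
    (if (k : ℕ) = 0 then M.init
      else M.site (σ ⟨(k : ℕ) - 1, lt_of_le_of_lt (Nat.sub_le _ _) k.isLt⟩))
    (M.site (σ k))

/-- The discounted return of a tour. -/
noncomputable def tourReturn {S A : Type*} {n : ℕ} (M : CollectibleMDP S A n) (γ : ℝ)
    (σ : Equiv.Perm (Fin n)) : ℝ :=
  ∑ k : Fin n, γ ^ (∑ t ∈ Finset.Iic k, M.tourLeg σ t)

/-- `OPT`, the maximal discounted return over all orders of collecting the rewards. -/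
noncomputable def opt {S A : Type*} {n : ℕ} (M : CollectibleMDP S A n) (γ : ℝ) : ℝ :=
  Finset.univ.sup' Finset.univ_nonempty (fun σ : Equiv.Perm (Fin n) => M.tourReturn γ σ)

/-! ### Options and their execution -/

/-- The state in which the agent is after following option `o j` for `t` steps from `x`. -/
def optionState {S A : Type*} {n : ℕ} (M : CollectibleMDP S A n) (o : Fin n → S → A)
    (j : Fin n) (x : S) (t : ℕ) : S :=
  (fun s => M.step s (o j s))^[t] x

/-- `o` is a family of optimal options, one per reward: started in the initial state or in any
reward state, `o j` arrives at reward `j` along a shortest path. In particular every reward can be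
reached from the initial state and from every other reward. -/
def OptimalOptions {S A : Type*} {n : ℕ} (M : CollectibleMDP S A n) (o : Fin n → S → A) : Prop :=
  ∀ x : S, (x = M.init ∨ ∃ i, x = M.site i) →
    ∀ j : Fin n, M.optionState o j x (M.dist x (M.site j)) = M.site j

open Classical in
/-- The rewards that have been collected strictly before time `t` when option `o j` is followed
from state `x`, with the rewards in `C` collected beforehand. -/
noncomputable def collectedBefore {S A : Type*} {n : ℕ} (M : CollectibleMDP S A n)
    (o : Fin n → S → A) (C : Finset (Fin n)) (x : S) (j : Fin n) (t : ℕ) : Finset (Fin n) :=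
  C ∪ Finset.univ.filter (fun i => ∃ u < t, M.optionState o j x u = M.site i)

/-- The discounted reward received while following option `o j` from state `x` until reward `j` is
reached (rewards passed on the way are collected too), with the rewards in `C` collected
beforehand. -/
noncomputable def legReturn {S A : Type*} {n : ℕ} (M : CollectibleMDP S A n) (γ : ℝ)
    (o : Fin n → S → A) (C : Finset (Fin n)) (x : S) (j : Fin n) : ℝ :=
  ∑ t ∈ Finset.range (M.dist x (M.site j) + 1),
    γ ^ t * M.reward (M.collectedBefore o C x j t) (M.optionState o j x t)

/-- The rewards collected once option `o j`, followed from `x`, has reached reward `j`. -/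
noncomputable def collectedAfter {S A : Type*} {n : ℕ} (M : CollectibleMDP S A n)
    (o : Fin n → S → A) (C : Finset (Fin n)) (x : S) (j : Fin n) : Finset (Fin n) :=
  M.collectedBefore o C x j (M.dist x (M.site j) + 1)

/-! ### Nearest neighbour and Random-NN -/

/-- `pick` is a nearest-neighbour rule: given the history `h` of the options followed so far, the
current state `x`, and the set `C` of the rewards collected so far, it picks a nearest remaining
reward. Ties may be broken in any way. -/
def IsNearestNeighbor {S A : Type*} {n : ℕ} (M : CollectibleMDP S A n)
    (pick : List (Fin n) → S → Finset (Fin n) → Fin n) : Prop :=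
  ∀ (h : List (Fin n)) (x : S) (C : Finset (Fin n)), C ≠ Finset.univ →
    pick h x C ∉ C ∧ ∀ i, i ∉ C → M.dist x (M.site (pick h x C)) ≤ M.dist x (M.site i)

/-- The discounted return of the policy that follows the options chosen by `pick` until all
rewards are collected, for at most `m` options. -/
noncomputable def pickReturn {S A : Type*} {n : ℕ} (M : CollectibleMDP S A n) (γ : ℝ)
    (o : Fin n → S → A) (pick : List (Fin n) → S → Finset (Fin n) → Fin n) :
    ℕ → List (Fin n) → S → Finset (Fin n) → ℝ
  | 0, _, _, _ => 0
  | m + 1, h, x, C =>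
    if C = Finset.univ then 0
    else
      M.legReturn γ o C x (pick h x C) +
        γ ^ M.dist x (M.site (pick h x C)) *
          pickReturn M γ o pick m (h ++ [pick h x C]) (M.site (pick h x C))
            (M.collectedAfter o C x (pick h x C))

/-- The return of NN from the initial state. (Each option collects a new reward, so `n` options
suffice to collect all of them.) -/
noncomputable def nnReturn {S A : Type*} {n : ℕ} (M : CollectibleMDP S A n) (γ : ℝ)
    (o : Fin n → S → A) (pick : List (Fin n) → S → Finset (Fin n) → Fin n) : ℝ :=
  M.pickReturn γ o pick n [] M.init ∅

/-- The return of the policy that first follows option `o j` to reward `j` and then runs NN. -/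
noncomputable def firstThenNNReturn {S A : Type*} {n : ℕ} (M : CollectibleMDP S A n) (γ : ℝ)
    (o : Fin n → S → A) (pick : List (Fin n) → S → Finset (Fin n) → Fin n) (j : Fin n) : ℝ :=
  M.legReturn γ o ∅ M.init j +
    γ ^ M.dist M.init (M.site j) *
      M.pickReturn γ o pick n [j] (M.site j) (M.collectedAfter o ∅ M.init j)

/-- The expected return of Random-NN: with probability `1/2` it runs NN, and with probability
`1/2` it first collects a uniformly random reward and then runs NN. -/
noncomputable def randomNNReturn {S A : Type*} {n : ℕ} (M : CollectibleMDP S A n) (γ : ℝ)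
    (o : Fin n → S → A) (pick : List (Fin n) → S → Finset (Fin n) → Fin n) : ℝ :=
  1 / 2 * M.nnReturn γ o pick +
    1 / 2 * ∑ j : Fin n, (1 / (n : ℝ)) * M.firstThenNNReturn γ o pick j

end CollectibleMDP

/-! Fix `p` of order `log n`. Choose a window length `δ` such that a delay of `2 ^ p * δ` costs at
most a factor 2 in discount, and cut the time axis of an optimal tour into windows of `δ + 1` steps.
If a window holds at least `p` rewards, these lie within `δ` of each other, and NN started at any of
them collects `p` rewards within `2 ^ p * δ` steps, so the random first reward recovers `p` times
the tour's payment up to a factor 2. Windows with fewer than `p` rewards form a geometric series of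
ratio at most `1 - 2 ^ (-(p + 1))`, whose scale is the discounted distance to the nearest reward,
which plain NN earns. Hence `p * OPT ≤ 2 * ∑ F + p ^ 2 * 2 ^ (p + 1) * NN`, and `p` about half of
`log₂ n` keeps the last coefficient `O(n)`. The charging is `mul_sum_pow_le_of_clusters`; NN on a
cluster is `pow_mul_min_le_pickReturn`. -/

/-- Among finitely many times `T i ≥ D`, those with at least `p` times close by are charged to `F`,
and the remaining ones form a geometric series. -/
theorem mul_sum_pow_le_of_clusters {ι : Type*} [Fintype ι] {γ : ℝ} (hγ0 : 0 ≤ γ) (hγ1 : γ < 1)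
    (T : ι → ℕ) (D : ℕ) (hD : ∀ i, D ≤ T i) (F : ι → ℝ) (hF0 : ∀ i, 0 ≤ F i) (p : ℕ)
    (hF : ∀ (i : ι) (δ : ℕ),
      p ≤ (Finset.univ.filter fun j => T i ≤ T j + δ ∧ T j ≤ T i + δ).card →
        p * γ ^ (T i + 2 ^ p * δ) ≤ F i) :
    p * ∑ i, γ ^ T i ≤ 2 * ∑ i, F i + p ^ 2 * 2 ^ (p + 1) * γ ^ D := by
  classical
  -- The largest `δ` whose delay costs at most a factor 2; the first bound serves crowded windows,
  -- the second sparse ones.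
  obtain ⟨δ, hδ, hδ'⟩ : ∃ δ : ℕ, 1 / 2 ≤ γ ^ (2 ^ p * δ) ∧ γ ^ (2 ^ p * (δ + 1)) < 1 / 2 := by
    have hex : ∃ δ : ℕ, γ ^ (2 ^ p * δ) < 1 / 2 := by
      obtain ⟨N, hN⟩ := exists_pow_lt_of_lt_one (by norm_num : (0 : ℝ) < 1 / 2) hγ1
      exact ⟨N, (pow_le_pow_of_le_one hγ0 hγ1.le
        (Nat.le_mul_of_pos_left N (by positivity))).trans_lt hN⟩
    have hpos : Nat.find hex ≠ 0 := by
      intro h0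
      have := Nat.find_spec hex
      rw [h0] at this
      norm_num at this
    obtain ⟨δ, hδ⟩ := Nat.exists_eq_succ_of_ne_zero hpos
    refine ⟨δ, not_lt.1 (Nat.find_min hex (by omega)), ?_⟩
    have := Nat.find_spec hex
    rwa [hδ] at this
  set y := γ ^ (δ + 1) with hy
  have hy0 : 0 ≤ y := pow_nonneg hγ0 _
  have hy1 : y < 1 := pow_lt_one₀ hγ0 hγ1 (by omega)
  -- Bernoulli: `1 - 2 ^ p * (1 - y) ≤ y ^ 2 ^ p < 1 / 2`.
  have hgap : 1 ≤ 2 ^ (p + 1) * (1 - y) := by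
    have hb := one_add_mul_le_pow (a := y - 1) (by linarith) (2 ^ p)
    have hyp : y ^ (2 ^ p) < 1 / 2 := by rwa [hy, ← pow_mul, mul_comm (δ + 1)]
    rw [show 1 + (y - 1) = y by ring] at hb
    push_cast at hb
    rw [pow_succ]
    linarith
  -- Window index; times in one window differ by at most `δ`.
  let b : ι → ℕ := fun i => (T i - D) / (δ + 1)
  let fib : ι → Finset ι := fun i => Finset.univ.filter fun j => b j = b i
  have hgood : ∀ i, p ≤ (fib i).card → p * γ ^ T i ≤ 2 * F i := by
    intro i hi
    have hsub : fib i ⊆ Finset.univ.filter fun j => T i ≤ T j + δ ∧ T j ≤ T i + δ := by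
      intro j hj
      simp only [fib, b, Finset.mem_filter, Finset.mem_univ, true_and] at hj ⊢
      have h1 := Nat.div_add_mod (T i - D) (δ + 1)
      have h2 := Nat.div_add_mod (T j - D) (δ + 1)
      have h3 := Nat.mod_lt (T i - D) (Nat.succ_pos δ)
      have h4 := Nat.mod_lt (T j - D) (Nat.succ_pos δ)
      have h5 := hD i
      have h6 := hD j
      rw [hj] at h2
      simp only [Nat.succ_eq_add_one] at h3 h4
      omega
    have := hF i δ (hi.trans (Finset.card_le_card hsub))
    rw [pow_add] at this
    have h2 : (p : ℝ) * γ ^ T i * (1 / 2) ≤ p * γ ^ T i * γ ^ (2 ^ p * δ) := by gcongr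
    linarith
  have hbad : ∑ i with ¬ p ≤ (fib i).card, γ ^ T i ≤ p * 2 ^ (p + 1) * γ ^ D := by
    set B := Finset.univ.filter fun i => ¬ p ≤ (fib i).card with hB
    have hterm : ∀ i, γ ^ T i ≤ γ ^ D * y ^ b i := by
      intro i
      rw [hy, ← pow_mul, ← pow_add]
      refine pow_le_pow_of_le_one hγ0 hγ1.le ?_
      have := Nat.mul_div_le (T i - D) (δ + 1)
      have h5 := hD i
      simp only [b]
      omega
    have hgeom : ∑ c ∈ B.image b, y ^ c ≤ 2 ^ (p + 1) := by
      calc ∑ c ∈ B.image b, y ^ c ≤ ∑' c, y ^ c :=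
            (summable_geometric_of_lt_one hy0 hy1).sum_le_tsum _ fun _ _ => pow_nonneg hy0 _
        _ = (1 - y)⁻¹ := tsum_geometric_of_lt_one hy0 hy1
        _ ≤ 2 ^ (p + 1) := by
            rw [inv_le_iff_one_le_mul₀ (by linarith)]
            exact hgap
    have hcount : ∑ i ∈ B, y ^ b i ≤ p * ∑ c ∈ B.image b, y ^ c := by
      rw [Finset.mul_sum, ← Finset.sum_fiberwise_of_maps_to
        (fun i hi => Finset.mem_image_of_mem b hi) (fun i => y ^ b i)]
      refine Finset.sum_le_sum fun c hc => ?_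
      obtain ⟨i, hi, rfl⟩ := Finset.mem_image.1 hc
      rw [Finset.sum_congr rfl (g := fun _ => y ^ b i)
        (fun j hj => by rw [(Finset.mem_filter.1 hj).2]), Finset.sum_const, nsmul_eq_mul]
      have hle : (B.filter fun j => b j = b i).card ≤ p := by
        refine le_trans (Finset.card_le_card ?_) (not_le.1 (Finset.mem_filter.1 hi).2).le
        exact Finset.filter_subset_filter _ (Finset.subset_univ _)
      gcongr
    calc ∑ i ∈ B, γ ^ T i ≤ ∑ i ∈ B, γ ^ D * y ^ b i := Finset.sum_le_sum fun i _ => hterm i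
      _ = γ ^ D * ∑ i ∈ B, y ^ b i := by rw [Finset.mul_sum]
      _ ≤ γ ^ D * (p * 2 ^ (p + 1)) := by
          gcongr
          exact hcount.trans (by gcongr)
      _ = _ := by ring
  have hgoodsum : p * ∑ i with p ≤ (fib i).card, γ ^ T i ≤ 2 * ∑ i, F i := by
    rw [Finset.mul_sum, Finset.mul_sum]
    calc _ ≤ ∑ i with p ≤ (fib i).card, 2 * F i :=
          Finset.sum_le_sum fun i hi => hgood i (Finset.mem_filter.1 hi).2
      _ ≤ ∑ i, 2 * F i := Finset.sum_le_sum_of_subset_of_nonneg (Finset.subset_univ _)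
          fun i _ _ => by have := hF0 i; positivity
  rw [← Finset.sum_filter_add_sum_filter_not Finset.univ (fun i => p ≤ (fib i).card), mul_add]
  have := mul_le_mul_of_nonneg_left hbad (Nat.cast_nonneg (α := ℝ) p)
  linarith

theorem Nat.sq_le_two_mul_two_pow (p : ℕ) : p ^ 2 ≤ 2 * 2 ^ p := by
  induction p with
  | zero => simp
  | succ q ih =>
    rcases Nat.lt_or_ge q 3 with h | h
    · interval_cases q <;> norm_num
    · rw [pow_succ 2 q]
      nlinarith

namespace CollectibleMDP

variable {S A : Type*} {n : ℕ} {M : CollectibleMDP S A n} {o : Fin n → S → A}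
  {pick : List (Fin n) → S → Finset (Fin n) → Fin n} {γ : ℝ}

/-! ### Distances -/

theorem dist_le_length (M : CollectibleMDP S A n) (s : S) (l : List A) :
    M.dist s (l.foldl M.step s) ≤ l.length :=
  Nat.sInf_le ⟨l, rfl, rfl⟩

theorem dist_self (M : CollectibleMDP S A n) (s : S) : M.dist s s = 0 :=
  Nat.le_zero.1 (M.dist_le_length s [])

theorem exists_foldl_eq_optionState (M : CollectibleMDP S A n) (o : Fin n → S → A) (j : Fin n)
    (t : ℕ) (x : S) : ∃ l : List A, l.length = t ∧ l.foldl M.step x = M.optionState o j x t := by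
  induction t generalizing x with
  | zero => exact ⟨[], rfl, rfl⟩
  | succ t ih =>
    obtain ⟨l, hl, h⟩ := ih (M.step x (o j x))
    exact ⟨o j x :: l, by simp [hl], by simpa [optionState] using h⟩

/-- Concatenate two option runs. Reachability matters: `dist` takes the default value 0 on
unreachable pairs. -/
theorem OptimalOptions.dist_triangle (ho : M.OptimalOptions o) {x : S}
    (hx : x = M.init ∨ ∃ i, x = M.site i) (i j : Fin n) :
    M.dist x (M.site j) ≤ M.dist x (M.site i) + M.dist (M.site i) (M.site j) := by
  obtain ⟨l, hl, h⟩ := M.exists_foldl_eq_optionState o i (M.dist x (M.site i)) x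
  obtain ⟨l', hl', h'⟩ :=
    M.exists_foldl_eq_optionState o j (M.dist (M.site i) (M.site j)) (M.site i)
  rw [ho x hx i] at h
  rw [ho _ (Or.inr ⟨i, rfl⟩) j] at h'
  have := M.dist_le_length x (l ++ l')
  rwa [List.foldl_append, h, h', List.length_append, hl, hl'] at this

/-! ### Tours -/

/-- The time at which a tour collects its `k`-th reward. -/
noncomputable def tourTime (M : CollectibleMDP S A n) (σ : Equiv.Perm (Fin n)) (k : Fin n) : ℕ :=
  ∑ t ∈ Finset.Iic k, M.tourLeg σ t

theorem tourTime_zero (M : CollectibleMDP S A n) (σ : Equiv.Perm (Fin n)) (h : 0 < n) :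
    M.tourTime σ ⟨0, h⟩ = M.dist M.init (M.site (σ ⟨0, h⟩)) := by
  have : Finset.Iic (⟨0, h⟩ : Fin n) = {⟨0, h⟩} := by
    ext t
    simp [Fin.le_def, Fin.ext_iff]
  simp [tourTime, this, tourLeg]

theorem tourTime_succ (M : CollectibleMDP S A n) (σ : Equiv.Perm (Fin n)) (k : ℕ)
    (h : k + 1 < n) :
    M.tourTime σ ⟨k + 1, h⟩ = M.tourTime σ ⟨k, by omega⟩ +
      M.dist (M.site (σ ⟨k, by omega⟩)) (M.site (σ ⟨k + 1, h⟩)) := by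
  have : Finset.Iic (⟨k + 1, h⟩ : Fin n) =
      insert ⟨k + 1, h⟩ (Finset.Iic (⟨k, by omega⟩ : Fin n)) := by
    ext t
    simp only [Finset.mem_Iic, Finset.mem_insert, Fin.le_def, Fin.ext_iff]
    omega
  rw [tourTime, this, Finset.sum_insert (by simp [Fin.le_def]), add_comm]
  simp [tourTime, tourLeg]

theorem OptimalOptions.dist_init_le_tourTime (ho : M.OptimalOptions o) (σ : Equiv.Perm (Fin n))
    (k : Fin n) : M.dist M.init (M.site (σ k)) ≤ M.tourTime σ k := by
  obtain ⟨k, hk⟩ := k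
  induction k with
  | zero => exact (M.tourTime_zero σ hk).ge
  | succ k ih =>
    rw [tourTime_succ]
    exact (ho.dist_triangle (Or.inl rfl) (σ ⟨k, by omega⟩) _).trans
      (Nat.add_le_add_right (ih (by omega)) _)

theorem OptimalOptions.tourTime_add_dist_le (ho : M.OptimalOptions o) (σ : Equiv.Perm (Fin n))
    {a b : Fin n} (hab : a ≤ b) :
    M.tourTime σ a + M.dist (M.site (σ a)) (M.site (σ b)) ≤ M.tourTime σ b := by
  obtain ⟨b, hb⟩ := b
  induction b with
  | zero =>
    obtain rfl : a = ⟨0, hb⟩ := le_antisymm hab (by simp [Fin.le_def])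
    simp [dist_self]
  | succ b ih =>
    rcases hab.eq_or_lt with rfl | hlt
    · simp [dist_self]
    · have h1 := ih (by omega) (by simp only [Fin.le_def, Fin.lt_def] at *; omega)
      have h2 := ho.dist_triangle (Or.inr ⟨σ a, rfl⟩) (σ ⟨b, by omega⟩) (σ ⟨b + 1, hb⟩)
      rw [tourTime_succ]
      omega

/-- The tour itself travels between the two rewards, in one direction; symmetry covers the other. -/
theorem OptimalOptions.dist_le_of_tourTime (ho : M.OptimalOptions o)
    (hsymm : ∀ i j : Fin n, M.dist (M.site i) (M.site j) = M.dist (M.site j) (M.site i))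
    (σ : Equiv.Perm (Fin n)) {a b : Fin n} {δ : ℕ} (h1 : M.tourTime σ a ≤ M.tourTime σ b + δ)
    (h2 : M.tourTime σ b ≤ M.tourTime σ a + δ) :
    M.dist (M.site (σ a)) (M.site (σ b)) ≤ δ := by
  rcases le_total a b with h | h
  · have := ho.tourTime_add_dist_le σ h
    omega
  · have := ho.tourTime_add_dist_le σ h
    rw [hsymm]
    omega

/-! ### Lower bounds for the returns -/

theorem reward_nonneg (M : CollectibleMDP S A n) (C : Finset (Fin n)) (s : S) :
    0 ≤ M.reward C s :=
  Finset.sum_nonneg fun i _ => by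
    unfold localReward
    split_ifs <;> norm_num

theorem legReturn_nonneg (hγ0 : 0 ≤ γ) (C : Finset (Fin n)) (x : S) (j : Fin n) :
    0 ≤ M.legReturn γ o C x j :=
  Finset.sum_nonneg fun _ _ => mul_nonneg (pow_nonneg hγ0 _) (M.reward_nonneg _ _)

theorem pickReturn_nonneg (hγ0 : 0 ≤ γ) (m : ℕ) (h : List (Fin n)) (x : S)
    (C : Finset (Fin n)) : 0 ≤ M.pickReturn γ o pick m h x C := by
  induction m generalizing h x C with
  | zero => simp [pickReturn]
  | succ m ih =>
    rw [pickReturn]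
    split_ifs
    · exact le_rfl
    · exact add_nonneg (legReturn_nonneg hγ0 _ _ _) (mul_nonneg (pow_nonneg hγ0 _) (ih _ _ _))

/-- Each new reward is paid at its first visit, no later than the end of the leg. -/
theorem pow_mul_card_le_legReturn (hγ0 : 0 ≤ γ) (hγ1 : γ ≤ 1) (C : Finset (Fin n)) (x : S)
    (j : Fin n) :
    γ ^ M.dist x (M.site j) * (M.collectedAfter o C x j \ C).card ≤ M.legReturn γ o C x j := by
  classical
  set d := M.dist x (M.site j) with hd
  have hcard : ((M.collectedAfter o C x j \ C).card : ℝ) ≤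
      ∑ t ∈ Finset.range (d + 1), M.reward (M.collectedBefore o C x j t)
        (M.optionState o j x t) := by
    have hrew : ∀ t, M.reward (M.collectedBefore o C x j t) (M.optionState o j x t) =
        ∑ i, if i ∉ M.collectedBefore o C x j t ∧ M.optionState o j x t = M.site i
          then (1 : ℝ) else 0 := by
      intro t
      refine (Finset.sum_congr rfl fun i hi => ?_).trans
        (Finset.sum_subset (Finset.subset_univ _) fun i _ hi => ?_)
      · simp [localReward, Finset.mem_compl.1 hi]
      · rw [Finset.mem_compl, not_not] at hi
        simp [hi]
    rw [Finset.sum_congr rfl fun t _ => hrew t, Finset.sum_comm, Finset.card_eq_sum_ones,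
      Nat.cast_sum]
    refine le_trans (Finset.sum_le_sum (g := fun i => ∑ t ∈ Finset.range (d + 1),
      if i ∉ M.collectedBefore o C x j t ∧ M.optionState o j x t = M.site i
        then (1 : ℝ) else 0) fun i hi => ?_)
      (Finset.sum_le_sum_of_subset_of_nonneg (Finset.subset_univ _) fun i _ _ =>
        Finset.sum_nonneg fun t _ => by split_ifs <;> norm_num)
    obtain ⟨hi, hiC⟩ := Finset.mem_sdiff.1 hi
    have hex : ∃ u, u < d + 1 ∧ M.optionState o j x u = M.site i := by
      simpa [collectedAfter, collectedBefore, hiC, ← hd] using hi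
    obtain ⟨hlt, heq⟩ := Nat.find_spec hex
    refine le_trans ?_ (Finset.single_le_sum (f := fun t =>
      if i ∉ M.collectedBefore o C x j t ∧ M.optionState o j x t = M.site i
        then (1 : ℝ) else 0) (fun t _ => by split_ifs <;> norm_num)
      (Finset.mem_range.2 hlt))
    have hnot : i ∉ M.collectedBefore o C x j (Nat.find hex) := by
      simp only [collectedBefore, Finset.mem_union, hiC, Finset.mem_filter, Finset.mem_univ,
        true_and, false_or, not_exists, not_and]
      exact fun u hu hui => Nat.find_min hex hu ⟨hu.trans hlt, hui⟩
    exact (Nat.cast_one (R := ℝ)).le.trans (if_pos ⟨hnot, heq⟩).ge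
  calc _ ≤ γ ^ d * ∑ t ∈ Finset.range (d + 1), M.reward (M.collectedBefore o C x j t)
        (M.optionState o j x t) := by gcongr
    _ ≤ _ := by
      rw [Finset.mul_sum, legReturn]
      refine Finset.sum_le_sum fun t ht => ?_
      exact mul_le_mul_of_nonneg_right
        (pow_le_pow_of_le_one hγ0 hγ1 (Nat.lt_succ_iff.1 (Finset.mem_range.1 ht)))
        (M.reward_nonneg _ _)

theorem OptimalOptions.mem_collectedAfter (ho : M.OptimalOptions o) {x : S}
    (hx : x = M.init ∨ ∃ i, x = M.site i) (C : Finset (Fin n)) (j : Fin n) :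
    j ∈ M.collectedAfter o C x j := by
  simp only [collectedAfter, collectedBefore, Finset.mem_union, Finset.mem_filter,
    Finset.mem_univ, true_and]
  exact Or.inr ⟨_, Nat.lt_succ_self _, ho x hx j⟩

/-- Starting from a reward with the rewards of `G` within distance `δ`, nearest neighbour collects
`p` rewards, or all of `G`, within time `(2 ^ p - 1) * δ`. -/
theorem OptimalOptions.pow_mul_min_le_pickReturn (ho : M.OptimalOptions o)
    (hsymm : ∀ i j : Fin n, M.dist (M.site i) (M.site j) = M.dist (M.site j) (M.site i))
    (hpick : M.IsNearestNeighbor pick) (hγ0 : 0 ≤ γ) (hγ1 : γ ≤ 1) (G : Finset (Fin n))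
    {p m : ℕ} (hpm : p ≤ m) (h : List (Fin n)) (i : Fin n) (C : Finset (Fin n)) (δ : ℕ)
    (hG : ∀ g ∈ G, M.dist (M.site i) (M.site g) ≤ δ) :
    γ ^ ((2 ^ p - 1) * δ) * (min p (G \ C).card : ℕ) ≤
      M.pickReturn γ o pick m h (M.site i) C := by
  induction p generalizing m h i C δ with
  | zero => simpa using pickReturn_nonneg hγ0 _ _ _ _
  | succ p ih =>
    obtain ⟨m, rfl⟩ : ∃ m', m = m' + 1 := ⟨m - 1, by omega⟩
    by_cases hGC : G ⊆ C
    · simpa [Finset.sdiff_eq_empty_iff_subset.2 hGC] using pickReturn_nonneg hγ0 _ _ _ _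
    obtain ⟨g, hg, hgC⟩ := Finset.not_subset.1 hGC
    have hC : C ≠ Finset.univ := by
      rintro rfl
      exact hgC (Finset.mem_univ _)
    rw [pickReturn, if_neg hC]
    obtain ⟨hjC, hj⟩ := hpick h (M.site i) C hC
    set j := pick h (M.site i) C
    have hjδ : M.dist (M.site i) (M.site j) ≤ δ := (hj g hgC).trans (hG g hg)
    set C' := M.collectedAfter o C (M.site i) j with hC'
    -- Moving to `j` at most doubles the radius of `G`, so the legs cost `δ + 2 * δ + 4 * δ + ⋯ = (2
    -- ^ p - 1) * δ`.
    have hrec := ih (m := m) (by omega) (h ++ [j]) j C' (2 * δ) fun g hg => by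
      have h1 := ho.dist_triangle (Or.inr ⟨j, rfl⟩) i g
      have h2 := hG g hg
      rw [hsymm j i] at h1
      omega
    have hleg := pow_mul_card_le_legReturn (M := M) (o := o) hγ0 hγ1 C (M.site i) j
    rw [← hC'] at hleg
    have hone : 1 ≤ (C' \ C).card := Finset.card_pos.2
      ⟨j, Finset.mem_sdiff.2 ⟨ho.mem_collectedAfter (Or.inr ⟨i, rfl⟩) C j, hjC⟩⟩
    have hcover : (G \ C).card ≤ (C' \ C).card + (G \ C').card := by
      refine (Finset.card_le_card ?_).trans (Finset.card_union_le _ _)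
      intro a ha
      simp only [Finset.mem_union, Finset.mem_sdiff] at ha ⊢
      tauto
    have hmin : min (p + 1) (G \ C).card ≤ (C' \ C).card + min p (G \ C').card := by omega
    have hexp : (2 ^ (p + 1) - 1) * δ = δ + (2 ^ p - 1) * (2 * δ) := by
      obtain ⟨q, hq⟩ : ∃ q, 2 ^ p = q + 1 := ⟨2 ^ p - 1, by have := Nat.two_pow_pos p; omega⟩
      rw [pow_succ, hq, show (q + 1) * 2 - 1 = 2 * q + 1 by omega, Nat.add_sub_cancel]
      ring
    set d := M.dist (M.site i) (M.site j)
    set E := (2 ^ p - 1) * (2 * δ)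
    calc γ ^ ((2 ^ (p + 1) - 1) * δ) * (min (p + 1) (G \ C).card : ℕ)
        ≤ γ ^ (δ + E) * ((C' \ C).card + (min p (G \ C').card : ℕ)) := by
          rw [hexp]
          gcongr
          exact_mod_cast hmin
      _ = γ ^ (δ + E) * (C' \ C).card + γ ^ δ * (γ ^ E * (min p (G \ C').card : ℕ)) := by ring
      _ ≤ γ ^ d * (C' \ C).card + γ ^ d * (γ ^ E * (min p (G \ C').card : ℕ)) := by
          have h1 : γ ^ (δ + E) ≤ γ ^ d := pow_le_pow_of_le_one hγ0 hγ1 (by omega)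
          have h2 : γ ^ δ ≤ γ ^ d := pow_le_pow_of_le_one hγ0 hγ1 hjδ
          gcongr
      _ ≤ _ := by gcongr

theorem firstThenNNReturn_nonneg (hγ0 : 0 ≤ γ) (j : Fin n) :
    0 ≤ M.firstThenNNReturn γ o pick j :=
  add_nonneg (legReturn_nonneg hγ0 _ _ _)
    (mul_nonneg (pow_nonneg hγ0 _) (pickReturn_nonneg hγ0 _ _ _ _))

theorem OptimalOptions.mul_pow_le_firstThenNNReturn (ho : M.OptimalOptions o)
    (hsymm : ∀ i j : Fin n, M.dist (M.site i) (M.site j) = M.dist (M.site j) (M.site i))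
    (hpick : M.IsNearestNeighbor pick) (hγ0 : 0 ≤ γ) (hγ1 : γ ≤ 1) (G : Finset (Fin n))
    {p : ℕ} (hp : p ≤ G.card) (i : Fin n) (δ : ℕ)
    (hG : ∀ g ∈ G, M.dist (M.site i) (M.site g) ≤ δ) :
    p * γ ^ (M.dist M.init (M.site i) + 2 ^ p * δ) ≤ M.firstThenNNReturn γ o pick i := by
  have hpn : p ≤ n := hp.trans (by simpa using Finset.card_le_univ G)
  set C := M.collectedAfter o ∅ M.init i with hC
  have hnn := ho.pow_mul_min_le_pickReturn hsymm hpick hγ0 hγ1 G hpn [i] i C δ hG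
  have hleg := pow_mul_card_le_legReturn (M := M) (o := o) hγ0 hγ1 ∅ M.init i
  rw [← hC, Finset.sdiff_empty] at hleg
  -- Members of `G` picked up on the way to `i` count towards the `p` rewards.
  have hcount : p ≤ C.card + min p (G \ C).card := by
    have := Finset.card_le_card_sdiff_add_card (s := G) (t := C)
    omega
  set d := M.dist M.init (M.site i)
  set E := (2 ^ p - 1) * δ with hE
  have hEle : E ≤ 2 ^ p * δ := Nat.mul_le_mul_right _ (Nat.sub_le _ _)
  calc (p : ℝ) * γ ^ (d + 2 ^ p * δ)
      ≤ (C.card + (min p (G \ C).card : ℕ)) * γ ^ (d + E) := by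
        have h1 : γ ^ (d + 2 ^ p * δ) ≤ γ ^ (d + E) :=
          pow_le_pow_of_le_one hγ0 hγ1 (by omega)
        gcongr
        exact_mod_cast hcount
    _ = γ ^ (d + E) * C.card + γ ^ d * (γ ^ E * (min p (G \ C).card : ℕ)) := by ring
    _ ≤ γ ^ d * C.card + γ ^ d * (γ ^ E * (min p (G \ C).card : ℕ)) := by
        have h1 : γ ^ (d + E) ≤ γ ^ d := pow_le_pow_of_le_one hγ0 hγ1 (by omega)
        gcongr
    _ ≤ _ := by
        rw [firstThenNNReturn]
        gcongr

theorem OptimalOptions.pow_le_nnReturn (ho : M.OptimalOptions o) (hn : 1 ≤ n)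
    (hpick : M.IsNearestNeighbor pick) (hγ0 : 0 ≤ γ) (hγ1 : γ ≤ 1) :
    γ ^ M.dist M.init (M.site (pick [] M.init ∅)) ≤ M.nnReturn γ o pick := by
  obtain ⟨m, rfl⟩ : ∃ m, n = m + 1 := ⟨n - 1, by omega⟩
  have hC : (∅ : Finset (Fin (m + 1))) ≠ Finset.univ := Finset.univ_nonempty.ne_empty.symm
  rw [nnReturn, pickReturn, if_neg hC]
  set j := pick [] M.init ∅
  have hleg := pow_mul_card_le_legReturn (M := M) (o := o) hγ0 hγ1 ∅ M.init j
  have hone : 1 ≤ (M.collectedAfter o ∅ M.init j \ ∅).card := Finset.card_pos.2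
    ⟨j, by simpa using ho.mem_collectedAfter (Or.inl rfl) ∅ j⟩
  have hone' : (1 : ℝ) ≤ (M.collectedAfter o ∅ M.init j \ ∅).card := by exact_mod_cast hone
  have h1 := le_mul_of_one_le_right (pow_nonneg hγ0 (M.dist M.init (M.site j))) hone'
  have h2 := mul_nonneg (pow_nonneg hγ0 (M.dist M.init (M.site j)))
    (pickReturn_nonneg (M := M) (o := o) (pick := pick) hγ0 m ([] ++ [j]) (M.site j)
      (M.collectedAfter o ∅ M.init j))
  linarith

/-- The return of a tour, bounded by the returns of the two branches of Random-NN. -/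
theorem OptimalOptions.mul_tourReturn_le (ho : M.OptimalOptions o) (hn : 1 ≤ n)
    (hsymm : ∀ i j : Fin n, M.dist (M.site i) (M.site j) = M.dist (M.site j) (M.site i))
    (hpick : M.IsNearestNeighbor pick) (hγ0 : 0 ≤ γ) (hγ1 : γ ≤ 1) (σ : Equiv.Perm (Fin n))
    {p : ℕ} (hp : p ≤ n) :
    p * M.tourReturn γ σ ≤ 2 * ∑ j, M.firstThenNNReturn γ o pick j +
      p ^ 2 * 2 ^ (p + 1) * M.nnReturn γ o pick := by
  have hnn := ho.pow_le_nnReturn hn hpick hγ0 hγ1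
  have hC : (∅ : Finset (Fin n)) ≠ Finset.univ := by
    have : Nonempty (Fin n) := ⟨⟨0, hn⟩⟩
    exact Finset.univ_nonempty.ne_empty.symm
  rw [← Equiv.sum_comp σ]
  rcases hγ1.eq_or_lt with rfl | hlt
  -- Without discounting no maximal `δ` exists, but all rewards form one cluster of finite radius.
  · have hnn0 : 0 ≤ M.nnReturn 1 o pick := pickReturn_nonneg zero_le_one _ _ _ _
    have hF : ∀ k, (p : ℝ) ≤ M.firstThenNNReturn 1 o pick (σ k) := fun k => by
      simpa using ho.mul_pow_le_firstThenNNReturn hsymm hpick hγ0 hγ1 Finset.univ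
        (by simpa using hp) (σ k) (∑ g, M.dist (M.site (σ k)) (M.site g))
        fun g hg => Finset.single_le_sum
          (f := fun g => M.dist (M.site (σ k)) (M.site g)) (fun _ _ => Nat.zero_le _) hg
    have hsum := Finset.sum_le_sum fun k (_ : k ∈ Finset.univ) => hF k
    simp only [Finset.sum_const, Finset.card_univ, Fintype.card_fin, nsmul_eq_mul] at hsum
    have htour : M.tourReturn 1 σ = n := by simp [tourReturn]
    have h0 : (0 : ℝ) ≤ n * p := by positivity
    have h1 : 0 ≤ (p : ℝ) ^ 2 * 2 ^ (p + 1) * M.nnReturn 1 o pick := by positivity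
    rw [htour]
    linarith
  · refine (mul_sum_pow_le_of_clusters hγ0 hlt (M.tourTime σ)
      (M.dist M.init (M.site (pick [] M.init ∅))) (fun k => ?_)
      (fun k => M.firstThenNNReturn γ o pick (σ k)) (fun k => firstThenNNReturn_nonneg hγ0 _) p
      fun k δ hk => ?_).trans ?_
    · exact ((hpick [] M.init ∅ hC).2 (σ k) (Finset.notMem_empty _)).trans
        (ho.dist_init_le_tourTime σ k)
    · refine le_trans ?_ (ho.mul_pow_le_firstThenNNReturn hsymm hpick hγ0 hγ1
        ((Finset.univ.filter fun l => M.tourTime σ k ≤ M.tourTime σ l + δ ∧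
          M.tourTime σ l ≤ M.tourTime σ k + δ).map σ.toEmbedding)
        (by simpa using hk) (σ k) δ ?_)
      · have := pow_le_pow_of_le_one hγ0 hγ1
          (Nat.add_le_add_right (ho.dist_init_le_tourTime σ k) (2 ^ p * δ))
        gcongr
      · intro g hg
        obtain ⟨l, hl, rfl⟩ := Finset.mem_map.1 hg
        have := (Finset.mem_filter.1 hl).2
        exact ho.dist_le_of_tourTime hsymm σ this.1 this.2
    · gcongr

end CollectibleMDP

/-! ### Choice of the cluster size and the constant -/

open CollectibleMDP in
theorem mainTheorem4 :
    ∃ c : ℝ, 0 < c ∧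
      ∀ (n : ℕ) (_hn : 1 ≤ n) (S A : Type*) (M : CollectibleMDP S A n)
        (_hsymm : ∀ i j : Fin n,
          M.dist (M.site i) (M.site j) = M.dist (M.site j) (M.site i))
        (o : Fin n → S → A) (_ho : M.OptimalOptions o)
        (pick : List (Fin n) → S → Finset (Fin n) → Fin n) (_hpick : M.IsNearestNeighbor pick)
        (γ : ℝ) (_hγ0 : 0 ≤ γ) (_hγ1 : γ ≤ 1),
        c * (Real.log n / n) * M.opt γ ≤ M.randomNNReturn γ o pick := by
  -- The final comparison with `4 * F + 32 * n * N` only needs `c ≤ 1 / 64`.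
  refine ⟨1 / 72, by norm_num, ?_⟩
  intro n hn S A M hsymm o ho pick hpick γ hγ0 hγ1
  have hn0 : (0 : ℝ) < n := by exact_mod_cast hn
  obtain ⟨σ, -, hσ⟩ := Finset.exists_mem_eq_sup' Finset.univ_nonempty
    (fun σ : Equiv.Perm (Fin n) => M.tourReturn γ σ)
  rw [opt, hσ]
  have hV : 0 ≤ M.tourReturn γ σ := Finset.sum_nonneg fun _ _ => pow_nonneg hγ0 _
  -- This gives `4 ^ (p - 1) ≤ n < 4 ^ p`; as `p ^ 2 ≤ 2 * 2 ^ p`, the sparse coefficient is at most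
  -- `4 * 4 ^ p ≤ 16 * n`.
  set p := Nat.log 2 n / 2 + 1 with hp
  have hlog : Real.log n ≤ 2 * p := by
    have h1 : n < 2 ^ (2 * p) :=
      (Nat.lt_pow_succ_log_self one_lt_two n).trans_le
        (Nat.pow_le_pow_right two_pos (by omega))
    have h2 : Real.log n ≤ Real.log (2 ^ (2 * p)) :=
      Real.log_le_log hn0 (by exact_mod_cast h1.le)
    rw [Real.log_pow] at h2
    push_cast at h2
    have h3 : Real.log 2 ≤ 1 := by linarith [Real.log_two_lt_d9]
    have h4 : (2 * p : ℝ) * Real.log 2 ≤ 2 * p := mul_le_of_le_one_right (by positivity) h3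
    linarith
  have hpn : p ≤ n := by
    have := Nat.log_lt_self 2 (show n ≠ 0 by omega)
    omega
  have hpow : p ^ 2 * 2 ^ (p + 1) ≤ 16 * n := by
    have h1 : 2 ^ (2 * (p - 1)) ≤ n :=
      (Nat.pow_le_pow_right two_pos (by omega)).trans (Nat.pow_log_le_self 2 (by omega))
    calc p ^ 2 * 2 ^ (p + 1) ≤ 2 * 2 ^ p * 2 ^ (p + 1) :=
          Nat.mul_le_mul_right _ (Nat.sq_le_two_mul_two_pow p)
      _ = 16 * 2 ^ (2 * (p - 1)) := by
          rw [hp, Nat.add_sub_cancel]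
          ring
      _ ≤ 16 * n := Nat.mul_le_mul_left _ h1
  have hpow' : (p : ℝ) ^ 2 * 2 ^ (p + 1) ≤ 16 * n := by exact_mod_cast hpow
  have hkey := ho.mul_tourReturn_le hn hsymm hpick hγ0 hγ1 σ hpn
  have hN : 0 ≤ M.nnReturn γ o pick := pickReturn_nonneg hγ0 _ _ _ _
  have hF : 0 ≤ ∑ j, M.firstThenNNReturn γ o pick j :=
    Finset.sum_nonneg fun j _ => firstThenNNReturn_nonneg hγ0 j
  rw [randomNNReturn, ← Finset.mul_sum]
  set F := ∑ j, M.firstThenNNReturn γ o pick j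
  set N := M.nnReturn γ o pick
  set V := M.tourReturn γ σ
  have h1 : Real.log n * V ≤ 2 * (2 * F + 16 * n * N) := by
    calc Real.log n * V ≤ 2 * p * V := by gcongr
      _ = 2 * (p * V) := by ring
      _ ≤ 2 * (2 * F + p ^ 2 * 2 ^ (p + 1) * N) := by gcongr
      _ ≤ 2 * (2 * F + 16 * n * N) := by gcongr
  have h2 : 1 / 72 * (Real.log n / n) * V = 1 / 72 * (Real.log n * V) / n := by ring
  have h3 : 1 / 2 * N + 1 / 2 * (1 / n * F) = (1 / 2 * (n * N) + 1 / 2 * F) / n := by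
    field_simp
  rw [h2, h3]
  gcongr
  have : 0 ≤ n * N := by positivity
  linarith
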